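/- **Proposition 23 (Kantorovich duality).** Let $d\ge 0$. Let $\mathcal M$ be the set of finite positive Borel measures on $\mathbb R^d$ and $\mathcal M^s$ the space of finite signed Borel measures on $\mathbb R^d$; for $\sigma\in\mathcal M^s$ with Jordan decomposition $(\sigma_+,\sigma_-)$ put $|\sigma|=\sigma_+(\mathbb R^d)+\sigma_-(\mathbb R^d)$. For $\alpha,\beta\in\mathcal M$ of the same mass let $W_1(\alpha,\beta)=\inf_\pi\int|x-y|\,d\pi(x,y)\in[0,\infty]$, where $\pi$ runs over the positive measures on $\mathbb R^d\times\mathbb R^d$ with marginals $\alpha$ and $\beta$. For $\alpha,\beta\in\mathcal M$ let $$W_1^{1,1}(\alpha,\beta)=\inf\bigl\{|\alpha-\tilde\alpha|+|\beta-\tilde\beta|+W_1(\tilde\alpha,\tilde\beta)\;:\;\tilde\alpha,\tilde\beta\in\mathcal M,\ |\tilde\alpha|=|\tilde\beta|\bigr\},$$ and for $\mu,\nu\in\mathcal M^s$ let $\mathbb W_1^{1,1}(\mu,\nu)=W_1^{1,1}(\mu_++\nu_-,\mu_-+\nu_+)$ and $\|\mu\|^{1,1}=\mathbb W_1^{1,1}(\mu,0)$,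 where $\mu=\mu_+-\mu_-$ and $\nu=\nu_+-\nu_-$ are the Jordan decompositions. Then for all $\mu,\nu\in\mathcal M^s$ the value $W_1^{1,1}(\mu_++\nu_-,\mu_-+\nu_+)$ is the same for all decompositions $\mu=\mu_+-\mu_-$, $\nu=\nu_+-\nu_-$ with $\mu_\pm,\nu_\pm\in\mathcal M$, it is finite, and $$\mathbb W_1^{1,1}(\mu,\nu)=\sup\Bigl\{\int_{\mathbb R^d}\varphi\,d(\mu-\nu)\;:\;\varphi:\mathbb R^d\to\mathbb R \text{ bounded and Lipschitz},\ \|\varphi\|_\infty\le1,\ \mathrm{Lip}(\varphi)\le1\Bigr\}.$$ In particular $\|\mu\|^{1,1}$ is finite and equals the bounded Lipschitz norm $\sup\{\int\varphi\,d\mu:\|\varphi\|_\infty\le1,\ \mathrm{Lip}(\varphi)\le1\}$. -/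

import Mathlib

open MeasureTheory
open scoped ENNReal NNReal BoundedContinuousFunction

noncomputable section

namespace SignedWasserstein

variable {E : Type*} [MeasurableSpace E]

/-- The difference of two finite positive measures, as a signed measure. -/
def diff (p n : FiniteMeasure E) : SignedMeasure E :=
  (p : Measure E).toSignedMeasure - (n : Measure E).toSignedMeasure

/-- The mass `|s| = s₊(E) + s₋(E)` of a signed measure, with `(s₊, s₋)` its Jordan decomposition. -/
def mass (s : SignedMeasure E) : ℝ≥0∞ := s.totalVariation Set.univ

/-- The transference plans between `μ` and `ν`: measures on `E × E` with marginals `μ` and `ν`. -/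
def plans (μ ν : FiniteMeasure E) : Set (Measure (E × E)) :=
  {π | π.map Prod.fst = (μ : Measure E) ∧ π.map Prod.snd = (ν : Measure E)}

/-- The Wasserstein distance `W₁(μ, ν)` of two finite measures of the same mass. It may be `∞`, as
no first moment is assumed. -/
def W₁ [PseudoEMetricSpace E] (μ ν : FiniteMeasure E) : ℝ≥0∞ :=
  ⨅ π ∈ plans μ ν, ∫⁻ z, edist z.1 z.2 ∂π

/-- The generalized Wasserstein distance `W₁^{a,b}(μ, ν)` of two finite positive measures: the
infimum of `a (|μ - μ'| + |ν - ν'|) + b W₁(μ', ν')` over all finite positive measures `μ'`, `ν'` of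
the same mass. -/
def genW₁ [PseudoEMetricSpace E] (a b : ℝ≥0) (μ ν : FiniteMeasure E) : ℝ≥0∞ :=
  ⨅ (μ' : FiniteMeasure E) (ν' : FiniteMeasure E) (_ : μ'.mass = ν'.mass),
    a * (mass (diff μ μ') + mass (diff ν ν')) + b * W₁ μ' ν'

/-- The positive part of the Jordan decomposition. -/
def posPart (s : SignedMeasure E) : FiniteMeasure E :=
  ⟨s.toJordanDecomposition.posPart, s.toJordanDecomposition.posPart_finite⟩

/-- The negative part of the Jordan decomposition. -/
def negPart (s : SignedMeasure E) : FiniteMeasure E :=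
  ⟨s.toJordanDecomposition.negPart, s.toJordanDecomposition.negPart_finite⟩

/-- The generalized Wasserstein distance of signed measures,
`𝕎₁^{a,b}(μ, ν) = W₁^{a,b}(μ₊ + ν₋, μ₋ + ν₊)`, computed with the Jordan decompositions. -/
def signedW₁ [PseudoEMetricSpace E] (a b : ℝ≥0) (μ ν : SignedMeasure E) : ℝ≥0∞ :=
  genW₁ a b (posPart μ + negPart ν) (negPart μ + posPart ν)

/-- The norm `‖μ‖^{a,b} = 𝕎₁^{a,b}(μ, 0)`. -/
def normW₁ [PseudoEMetricSpace E] (a b : ℝ≥0) (μ : SignedMeasure E) : ℝ≥0∞ :=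
  signedW₁ a b μ 0

/-- The bounded continuous functions with `‖φ‖_∞ ≤ 1` and Lipschitz constant at most `1`. -/
def blBall (E : Type*) [PseudoEMetricSpace E] : Set (E →ᵇ ℝ) :=
  {φ | ‖φ‖ ≤ 1 ∧ LipschitzWith 1 φ}

/-- The set of values `∫ φ ds` over the test functions of `blBall`; its supremum is the bounded
Lipschitz norm of `s`. -/
def blValues [PseudoEMetricSpace E] (s : SignedMeasure E) : Set ℝ :=
  {r | ∃ φ ∈ blBall E, r = ∫ᵛ x, φ x ∂<•s}

end SignedWasserstein

end

/-! Weak duality (`integral_sub_integral_le_genW₁`): split the integral of a test function along α →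
α̃ → β̃ → β; the bound on its norm pays for the outer steps, the Lipschitz bound for the middle one.
For the converse, a countable partition into small cells reduces both measures to finitely many
weights, up to small mass. The optimal value of the discrete unbalanced problem is sublinear in the
weights, so Hahn–Banach gives a linear minorant touching it at the given weights, whose coordinates
are dual potentials (`exists_dual_potentials`). A truncated infimum of cones merges them into one
admissible function (`exists_mem_blBall_of_potentials`), and all errors are O(ε). No optimal plan or
moment bound is needed. The dual side sees only the difference of the two measures, hence
independence of the decomposition. -/

namespace SignedWasserstein

/-! ### Finite unbalanced transport and Hahn–Banach -/

section FiniteDuality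

/-- A sublinear function on a real vector space has a linear minorant touching it at a given
point. -/
theorem exists_linear_le_sublinear_eq {V : Type*} [AddCommGroup V] [Module ℝ V] (N : V → ℝ)
    (N_hom : ∀ c : ℝ, 0 < c → ∀ x, N (c • x) = c * N x)
    (N_add : ∀ x y, N (x + y) ≤ N x + N y) (x₀ : V) :
    ∃ g : V →ₗ[ℝ] ℝ, g x₀ = N x₀ ∧ ∀ x, g x ≤ N x := by
  have N_zero : N 0 = 0 := by
    have := N_hom 2 two_pos 0
    rw [smul_zero] at this
    linarith
  by_cases hx₀ : x₀ = 0
  · obtain ⟨g, -, hg⟩ := exists_extension_of_le_sublinear ⟨⊥, 0⟩ N N_hom N_add (by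
      rintro ⟨x, hx⟩
      obtain rfl : x = 0 := (Submodule.mem_bot ℝ).1 hx
      exact N_zero.ge)
    exact ⟨g, by simp [hx₀, N_zero], hg⟩
  · obtain ⟨g, hg₀, hg⟩ := exists_extension_of_le_sublinear
      (LinearPMap.mkSpanSingleton (K := ℝ) x₀ (N x₀) hx₀) N N_hom N_add (by
      rintro ⟨x, hx⟩
      obtain ⟨t, rfl⟩ := Submodule.mem_span_singleton.1 hx
      refine (LinearPMap.mkSpanSingleton'_apply x₀ (N x₀) _ t hx).trans_le ?_
      rw [smul_eq_mul, RingHom.id_apply]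
      change t * N x₀ ≤ N (t • x₀)
      rcases lt_trichotomy t 0 with ht | rfl | ht
      -- For negative `t`, subadditivity at opposite vectors gives `0 ≤ N (t • x₀) + N (-t • x₀)`.
      · have h₁ := N_add (t • x₀) ((-t) • x₀)
        rw [← add_smul, add_neg_cancel, zero_smul, N_zero, N_hom (-t) (by linarith)] at h₁
        linarith
      · simp [N_zero]
      · rw [N_hom t ht])
    refine ⟨g, ?_, hg⟩
    have := hg₀ ⟨x₀, Submodule.mem_span_singleton_self x₀⟩
    rw [this]
    exact LinearPMap.mkSpanSingleton_apply ℝ ℝ hx₀ (N x₀)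

variable {ι : Type*} [Fintype ι]

/-- The cost of the transference matrix `m` between the weights `u` and `w` in the unbalanced
discrete transport problem. -/
noncomputable def matrixCost (c : ι → ι → ℝ) (u w : ι → ℝ) (m : ι → ι → ℝ≥0) : ℝ :=
  (∑ i, |u i - ∑ j, (m i j : ℝ)| + ∑ j, |w j - ∑ i, (m i j : ℝ)|) + ∑ i, ∑ j, m i j * c i j

theorem matrixCost_nonneg {c : ι → ι → ℝ} (hc : ∀ i j, 0 ≤ c i j) (u w : ι → ℝ)
    (m : ι → ι → ℝ≥0) : 0 ≤ matrixCost c u w m := by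
  unfold matrixCost
  have : ∀ i j, 0 ≤ (m i j : ℝ) * c i j := fun i j ↦ mul_nonneg (m i j).2 (hc i j)
  have := Finset.sum_nonneg fun i (_ : i ∈ Finset.univ) ↦
    Finset.sum_nonneg fun j (_ : j ∈ Finset.univ) ↦ this i j
  positivity

theorem matrixCost_smul (c : ι → ι → ℝ) (u w : ι → ℝ) (m : ι → ι → ℝ≥0) (t : ℝ≥0) :
    matrixCost c ((t : ℝ) • u) ((t : ℝ) • w) (t • m) = t * matrixCost c u w m := by
  have h (x y : ℝ) : |(t : ℝ) * x - t * y| = t * |x - y| := by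
    rw [← mul_sub, abs_mul, abs_of_nonneg t.coe_nonneg]
  simp [matrixCost, ← Finset.mul_sum, h, mul_add, mul_assoc]

theorem matrixCost_add_le (c : ι → ι → ℝ) (u w u' w' : ι → ℝ) (m m' : ι → ι → ℝ≥0) :
    matrixCost c (u + u') (w + w') (m + m') ≤ matrixCost c u w m + matrixCost c u' w' m' := by
  have h (x x' y y' : ℝ) : |x + x' - (y + y')| ≤ |x - y| + |x' - y'| := by
    rw [add_sub_add_comm]
    exact abs_add_le _ _
  have h₁ : ∑ i, |u i + u' i - (∑ j, (m i j : ℝ) + ∑ j, (m' i j : ℝ))| ≤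
      ∑ i, |u i - ∑ j, (m i j : ℝ)| + ∑ i, |u' i - ∑ j, (m' i j : ℝ)| := by
    rw [← Finset.sum_add_distrib]
    exact Finset.sum_le_sum fun i _ ↦ h _ _ _ _
  have h₂ : ∑ j, |w j + w' j - (∑ i, (m i j : ℝ) + ∑ i, (m' i j : ℝ))| ≤
      ∑ j, |w j - ∑ i, (m i j : ℝ)| + ∑ j, |w' j - ∑ i, (m' i j : ℝ)| := by
    rw [← Finset.sum_add_distrib]
    exact Finset.sum_le_sum fun i _ ↦ h _ _ _ _
  simp only [matrixCost, Pi.add_apply, NNReal.coe_add, Finset.sum_add_distrib, add_mul]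
  linarith

/-- Duality for the unbalanced discrete transport problem: there are dual potentials whose value is
the infimum of the cost. -/
theorem exists_dual_potentials {c : ι → ι → ℝ} (hc : ∀ i j, 0 ≤ c i j) (u w : ι → ℝ) :
    ∃ φ ψ : ι → ℝ, (∀ i, |φ i| ≤ 1) ∧ (∀ j, |ψ j| ≤ 1) ∧ (∀ i j, φ i + ψ j ≤ c i j) ∧
      ∀ η > 0, ∃ m, matrixCost c u w m < ∑ i, u i * φ i + ∑ j, w j * ψ j + η := by
  classical
  set N : (ι → ℝ) × (ι → ℝ) → ℝ := fun z ↦ ⨅ m, matrixCost c z.1 z.2 m with hN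
  have N_le (z) (m) : N z ≤ matrixCost c z.1 z.2 m :=
    ciInf_le ⟨0, by rintro _ ⟨m, rfl⟩; exact matrixCost_nonneg hc _ _ m⟩ m
  have exists_lt (z) (η : ℝ) (hη : 0 < η) : ∃ m, matrixCost c z.1 z.2 m < N z + η :=
    exists_lt_of_ciInf_lt (by simpa [hN] using hη)
  have N_smul_le (t : ℝ) (ht : 0 < t) (z) : N (t • z) ≤ t * N z := by
    refine le_of_forall_pos_le_add fun η hη ↦ ?_
    obtain ⟨m, hm⟩ := exists_lt z (η / t) (by positivity)
    lift t to ℝ≥0 using ht.le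
    calc N ((t : ℝ) • z) ≤ _ := N_le _ (t • m)
      _ = t * matrixCost c z.1 z.2 m := matrixCost_smul c z.1 z.2 m t
      _ ≤ t * (N z + η / t) := by gcongr
      _ = t * N z + η := by field_simp
  have N_smul (t : ℝ) (ht : 0 < t) (z) : N (t • z) = t * N z := by
    refine le_antisymm (N_smul_le t ht z) ?_
    have := N_smul_le t⁻¹ (inv_pos.2 ht) (t • z)
    rw [inv_smul_smul₀ ht.ne'] at this
    calc t * N z ≤ t * (t⁻¹ * N (t • z)) := by gcongr
      _ = N (t • z) := by field_simp
  have N_add (z z') : N (z + z') ≤ N z + N z' := by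
    refine le_of_forall_pos_le_add fun η hη ↦ ?_
    obtain ⟨m, hm⟩ := exists_lt z (η / 2) (by positivity)
    obtain ⟨m', hm'⟩ := exists_lt z' (η / 2) (by positivity)
    calc N (z + z') ≤ _ := N_le _ (m + m')
      _ ≤ _ := matrixCost_add_le c z.1 z.2 z'.1 z'.2 m m'
      _ ≤ N z + N z' + η := by linarith
  obtain ⟨g, hg₀, hg⟩ := exists_linear_le_sublinear_eq N N_smul N_add (u, w)
  have abs_sum (i : ι) : ∑ x, |(Pi.single i (1 : ℝ) : ι → ℝ) x| = 1 := by
    simp [Pi.single_apply, apply_ite abs]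
  -- The constraints come from testing `g ≤ N` on unit weights: transporting nothing costs 1, and
  -- moving one unit from `i` to `j` costs `c i j`.
  refine ⟨fun i ↦ g (Pi.single i 1, 0), fun j ↦ g (0, Pi.single j 1), fun i ↦ ?_, fun j ↦ ?_,
    fun i j ↦ ?_, fun η hη ↦ ?_⟩
  · refine abs_le'.2 ⟨(hg _).trans ((N_le _ 0).trans ?_), ?_⟩
    · simp [matrixCost, abs_sum]
    · rw [← map_neg]
      refine (hg _).trans ((N_le _ 0).trans ?_)
      simp [matrixCost, abs_sum]
  · refine abs_le'.2 ⟨(hg _).trans ((N_le _ 0).trans ?_), ?_⟩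
    · simp [matrixCost, abs_sum]
    · rw [← map_neg]
      refine (hg _).trans ((N_le _ 0).trans ?_)
      simp [matrixCost, abs_sum]
  · rw [← map_add]
    refine (hg _).trans ((N_le _ (Pi.single i (Pi.single j 1))).trans ?_)
    have h₁ (k : ι) : ∑ l, ((Pi.single i (Pi.single j 1) : ι → ι → ℝ≥0) k l : ℝ) =
        (Pi.single i 1 : ι → ℝ) k := by
      by_cases hk : k = i
      · subst hk
        simp [Pi.single_apply, apply_ite NNReal.toReal]
      · simp [hk]
    have h₂ (l : ι) : ∑ k, ((Pi.single i (Pi.single j 1) : ι → ι → ℝ≥0) k l : ℝ) =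
        (Pi.single j 1 : ι → ℝ) l := by
      rw [Finset.sum_eq_single i (fun k _ hk ↦ by simp [hk]) (by simp)]
      by_cases hl : l = j <;> simp [hl]
    have h₃ : ∑ k, ∑ l, ((Pi.single i (Pi.single j 1) : ι → ι → ℝ≥0) k l : ℝ) * c k l = c i j := by
      rw [Finset.sum_eq_single i (fun k _ hk ↦ by simp [hk]) (by simp),
        Finset.sum_eq_single j (fun k _ hk ↦ by simp [hk]) (by simp)]
      simp
    simp [matrixCost, h₁, h₂, h₃]
  · obtain ⟨m, hm⟩ := exists_lt (u, w) η hη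
    refine ⟨m, hm.trans_eq ?_⟩
    congr 1
    rw [← hg₀]
    have : ((u, w) : (ι → ℝ) × (ι → ℝ)) = ∑ i, u i • ((Pi.single i 1 : ι → ℝ), (0 : ι → ℝ)) +
        ∑ j, w j • ((0 : ι → ℝ), (Pi.single j 1 : ι → ℝ)) := by
      ext k <;> simp [Prod.fst_sum, Prod.snd_sum, Finset.sum_apply, Pi.single_apply]
    conv_lhs => rw [this]
    simp only [map_add, map_sum, map_smul, smul_eq_mul]

end FiniteDuality

/-! ### Differences of positive measures and their mass -/

section Diff

variable {E : Type*} [MeasurableSpace E]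

theorem diff_eq_diff_iff {p n p' n' : FiniteMeasure E} :
    diff p n = diff p' n' ↔ p + n' = p' + n := by
  rw [diff, diff, sub_eq_sub_iff_add_eq_add, ← Measure.toSignedMeasure_add,
    ← Measure.toSignedMeasure_add, Measure.toSignedMeasure_eq_toSignedMeasure_iff,
    ← FiniteMeasure.toMeasure_add, ← FiniteMeasure.toMeasure_add]
  exact Subtype.val_injective.eq_iff

theorem diff_posPart_negPart (s : SignedMeasure E) : diff (posPart s) (negPart s) = s :=
  s.toSignedMeasure_toJordanDecomposition

theorem diff_sub_diff (p n p' n' : FiniteMeasure E) :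
    diff p n - diff p' n' = diff (p + n') (n + p') := by
  simp only [diff, FiniteMeasure.toMeasure_add, Measure.toSignedMeasure_add]
  abel

theorem diff_signed (μ ν : SignedMeasure E) :
    diff (posPart μ + negPart ν) (negPart μ + posPart ν) = μ - ν := by
  rw [← diff_sub_diff, diff_posPart_negPart, diff_posPart_negPart]

theorem mass_eq (s : SignedMeasure E) : mass s = (posPart s).mass + (negPart s).mass := by
  rw [FiniteMeasure.ennreal_mass, FiniteMeasure.ennreal_mass]
  rfl

theorem mass_diff_le (p n : FiniteMeasure E) : mass (diff p n) ≤ p.mass + n.mass := by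
  rw [mass, SignedMeasure.totalVariation, diff, Measure.toJordanDecomposition_toSignedMeasure_sub]
  rw [Measure.add_apply, Measure.jordanDecompositionOfToSignedMeasureSub_posPart,
    Measure.jordanDecompositionOfToSignedMeasureSub_negPart, FiniteMeasure.ennreal_mass,
    FiniteMeasure.ennreal_mass]
  exact add_le_add (Measure.sub_le Set.univ) (Measure.sub_le Set.univ)

theorem mass_diff_le_of_add_eq {μ μ' p n : FiniteMeasure E} (h : μ + n = μ' + p) :
    mass (diff μ μ') ≤ p.mass + n.mass := by
  rw [diff_eq_diff_iff.2 (h.trans (add_comm _ _) : μ + n = p + μ')]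
  exact mass_diff_le p n

variable [TopologicalSpace E] [OpensMeasurableSpace E]

theorem integral_diff (p n : FiniteMeasure E) (φ : E →ᵇ ℝ) :
    ∫ᵛ x, φ x ∂<•(diff p n) = ∫ x, φ x ∂(p : Measure E) - ∫ x, φ x ∂(n : Measure E) := by
  have h (q : FiniteMeasure E) : (q : Measure E).toSignedMeasure.Integrable φ := by
    rw [VectorMeasure.Integrable, Measure.variation_toSignedMeasure]
    exact φ.integrable _
  rw [diff, VectorMeasure.integral_sub_vectorMeasure (h p) (h n)]
  simp

theorem abs_integral_le_mass {φ : E →ᵇ ℝ} (hφ : ‖φ‖ ≤ 1) (p : FiniteMeasure E) :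
    |∫ x, φ x ∂(p : Measure E)| ≤ p.mass := by
  have := φ.norm_integral_le_mul_norm (p : Measure E)
  rw [Real.norm_eq_abs] at this
  exact this.trans (mul_le_of_le_one_right measureReal_nonneg hφ)

theorem integral_sub_integral_le_mass {φ : E →ᵇ ℝ} (hφ : ‖φ‖ ≤ 1) (p n : FiniteMeasure E) :
    ENNReal.ofReal |∫ x, φ x ∂(p : Measure E) - ∫ x, φ x ∂(n : Measure E)| ≤ mass (diff p n) := by
  rw [← integral_diff]
  conv_lhs => rw [← diff_posPart_negPart (diff p n), integral_diff]
  rw [mass_eq, ← ENNReal.coe_add]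
  refine ENNReal.ofReal_le_of_le_toReal ?_
  have h₁ := abs_integral_le_mass hφ (posPart (diff p n))
  have h₂ := abs_integral_le_mass hφ (negPart (diff p n))
  exact (abs_sub _ _).trans (add_le_add h₁ h₂)

end Diff

/-! ### Weak duality -/

section WeakDuality

variable {E : Type*} [MeasurableSpace E] [PseudoEMetricSpace E]

theorem genW₁_ne_top (μ ν : FiniteMeasure E) : genW₁ 1 1 μ ν ≠ ∞ := by
  have hW : W₁ (0 : FiniteMeasure E) 0 = 0 :=
    le_antisymm ((iInf₂_le 0 (by simp [plans])).trans (by simp)) zero_le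
  refine ne_top_of_le_ne_top ?_ (iInf_le_of_le 0 (iInf_le_of_le 0 (iInf_le _ rfl)))
  simp [hW, mass_eq]

variable [OpensMeasurableSpace E]

theorem integral_sub_integral_le_lintegral_edist {μ ν : FiniteMeasure E} {π : Measure (E × E)}
    (hπ : π ∈ plans μ ν) {φ : E →ᵇ ℝ} (hφ : LipschitzWith 1 φ) :
    ENNReal.ofReal |∫ x, φ x ∂(μ : Measure E) - ∫ x, φ x ∂(ν : Measure E)| ≤
      ∫⁻ z, edist z.1 z.2 ∂π := by
  have hμ := φ.integrable (μ : Measure E)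
  have hν := φ.integrable (ν : Measure E)
  rw [← hπ.1] at hμ ⊢
  rw [← hπ.2] at hν ⊢
  rw [integral_map measurable_fst.aemeasurable hμ.1, integral_map measurable_snd.aemeasurable hν.1,
    ← integral_sub (f := fun z : E × E ↦ φ z.1) (g := fun z : E × E ↦ φ z.2)
      (hμ.comp_measurable measurable_fst) (hν.comp_measurable measurable_snd),
    ← Real.norm_eq_abs, ofReal_norm]
  refine (enorm_integral_le_lintegral_enorm _).trans (lintegral_mono fun z ↦ ?_)
  simpa [edist_eq_enorm_sub] using hφ z.1 z.2

theorem integral_sub_integral_le_genW₁ (μ ν : FiniteMeasure E) {φ : E →ᵇ ℝ} (hφ : φ ∈ blBall E) :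
    ENNReal.ofReal (∫ x, φ x ∂(μ : Measure E) - ∫ x, φ x ∂(ν : Measure E)) ≤ genW₁ 1 1 μ ν := by
  refine le_iInf fun μ' ↦ le_iInf fun ν' ↦ le_iInf fun _ ↦ ?_
  simp only [ENNReal.coe_one, one_mul]
  -- Subtracting the mass terms isolates `W₁`, so that its infimum can be unfolded to a single plan.
  rw [← tsub_le_iff_left]
  refine le_iInf₂ fun π hπ ↦ ?_
  rw [tsub_le_iff_left]
  refine le_trans ?_ (add_le_add (add_le_add (integral_sub_integral_le_mass hφ.1 μ μ')
    (integral_sub_integral_le_mass hφ.1 ν ν')) (integral_sub_integral_le_lintegral_edist hπ hφ.2))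
  rw [← ENNReal.ofReal_add (abs_nonneg _) (abs_nonneg _),
    ← ENNReal.ofReal_add (by positivity) (abs_nonneg _)]
  refine ENNReal.ofReal_le_ofReal ?_
  set a := ∫ x, φ x ∂(μ : Measure E)
  set a' := ∫ x, φ x ∂(μ' : Measure E)
  set b := ∫ x, φ x ∂(ν : Measure E)
  set b' := ∫ x, φ x ∂(ν' : Measure E)
  linarith [le_abs_self (a - a'), neg_abs_le (b - b'), le_abs_self (a' - b')]

end WeakDuality

/-- Discrete dual potentials for an enlarged cost extend to a single bounded Lipschitz function. -/
theorem exists_mem_blBall_of_potentials {E ι : Type*} [PseudoMetricSpace E]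
    [Finite ι] {x : ι → E} {ε : ℝ} (hε : 0 ≤ ε) {φ ψ : ι → ℝ}
    (hφ : ∀ i, φ i ≤ 1) (hψ : ∀ j, ψ j ≤ 1)
    (hφψ : ∀ i j, φ i + ψ j ≤ dist (x i) (x j) + 2 * ε) :
    ∃ f ∈ blBall E, ∀ i y, dist y (x i) ≤ ε → φ i - 3 * ε ≤ f y ∧ f y ≤ -ψ i + ε := by
  -- The index `none` caps the infimum at 1; the lower bound -1 is automatic from `ψ j ≤ 1`.
  let h : Option ι → E → ℝ := fun o y ↦ o.elim 1 fun j ↦ dist y (x j) - ψ j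
  let g : E → ℝ := fun y ↦ ⨅ o, h o y
  have g_le (o y) : g y ≤ h o y := ciInf_le (Set.finite_range _).bddBelow o
  have lip : LipschitzWith 1 g := by
    refine LipschitzWith.of_le_add fun y z ↦ ?_
    rw [← sub_le_iff_le_add]
    refine le_ciInf fun o ↦ ?_
    rw [sub_le_iff_le_add]
    refine (g_le o y).trans ?_
    rcases o with _ | j
    · exact le_add_of_nonneg_right dist_nonneg
    · change dist y (x j) - ψ j ≤ dist z (x j) - ψ j + dist y z
      linarith [dist_triangle y z (x j)]
  have abs_g_le (y) : ‖g y‖ ≤ 1 := by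
    refine abs_le.2 ⟨le_ciInf fun o ↦ ?_, g_le none y⟩
    rcases o with _ | j
    · exact neg_le_self zero_le_one
    · change -1 ≤ dist y (x j) - ψ j
      linarith [hψ j, dist_nonneg (x := y) (y := x j)]
  refine ⟨BoundedContinuousFunction.ofNormedAddCommGroup g lip.continuous 1 abs_g_le,
    ⟨BoundedContinuousFunction.norm_ofNormedAddCommGroup_le _ zero_le_one abs_g_le, lip⟩,
    fun i y hy ↦ ⟨le_ciInf fun o ↦ ?_, (g_le (some i) y).trans ?_⟩⟩
  · rcases o with _ | j
    · change φ i - 3 * ε ≤ 1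
      linarith [hφ i]
    · change φ i - 3 * ε ≤ dist y (x j) - ψ j
      have := dist_triangle (x i) y (x j)
      rw [dist_comm (x i) y] at this
      linarith [hφψ i j]
  · change dist y (x i) - ψ i ≤ -ψ i + ε
    linarith

variable {E : Type*} [MeasurableSpace E]

/-! ### Comparison with the discrete problem -/

section Discretization

variable {ι : Type*} [Fintype ι]

theorem mass_add (μ ν : FiniteMeasure E) : (μ + ν).mass = μ.mass + ν.mass := by
  simp [FiniteMeasure.mass]

theorem mass_smul (c : ℝ≥0) (μ : FiniteMeasure E) : (c • μ).mass = c * μ.mass := by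
  simp [FiniteMeasure.mass]

theorem mass_sum (μ : ι → FiniteMeasure E) : (∑ i, μ i).mass = ∑ i, (μ i).mass := by
  rw [← ENNReal.coe_inj, FiniteMeasure.ennreal_mass, FiniteMeasure.toMeasure_sum,
    Measure.finsetSum_apply]
  simp

variable [PseudoMetricSpace E]

/-- A splitting of the finite measure `μ` into multiples of probability measures concentrated near
the points `x i`, up to a remainder of small mass. -/
structure Discretization (x : ι → E) (ε : ℝ) (μ : FiniteMeasure E) where
  /-- the weights -/
  weight : ι → ℝ≥0
  /-- the probability measures concentrated near the points `x i` -/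
  law : ι → FiniteMeasure E
  /-- the remainder -/
  rest : FiniteMeasure E
  mass_law : ∀ i, (law i).mass = 1
  ae_dist_le : ∀ i, ∀ᵐ y ∂(law i : Measure E), dist y (x i) ≤ ε
  mass_rest_le : rest.mass ≤ ε
  eq_add : μ = ∑ i, weight i • law i + rest

theorem mass_sum_smul_law {x : ι → E} {ε : ℝ} {μ : FiniteMeasure E} (D : Discretization x ε μ)
    (r : ι → ℝ≥0) : (∑ i, r i • D.law i).mass = ∑ i, r i := by
  simp [mass_sum, mass_smul, D.mass_law]

theorem Discretization.sum_weight_le {x : ι → E} {ε : ℝ} {μ : FiniteMeasure E}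
    (D : Discretization x ε μ) : ∑ i, (D.weight i : ℝ) ≤ μ.mass := by
  conv_rhs => rw [D.eq_add, mass_add, mass_sum_smul_law]
  push_cast
  linarith [D.rest.mass.coe_nonneg]

/-- Raising both sets of weights to their maximum gives a common measure; truncated subtraction
supplies the amounts to add, which total `|D.weight i - r i|` at each index. -/
theorem Discretization.mass_diff_le {x : ι → E} {ε : ℝ} {μ : FiniteMeasure E}
    (D : Discretization x ε μ) (r : ι → ℝ≥0) :
    mass (diff μ (∑ i, r i • D.law i)) ≤
      ENNReal.ofReal (∑ i, |(D.weight i : ℝ) - r i| + ε) := by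
  have h : μ + ∑ i, (r i - D.weight i) • D.law i =
      ∑ i, r i • D.law i + (∑ i, (D.weight i - r i) • D.law i + D.rest) := by
    refine (congrArg (· + ∑ i, (r i - D.weight i) • D.law i) D.eq_add).trans ?_
    rw [add_right_comm, ← add_assoc, ← Finset.sum_add_distrib, ← Finset.sum_add_distrib]
    simp only [← add_smul, add_tsub_eq_max, max_comm]
  refine (mass_diff_le_of_add_eq h).trans ?_
  rw [mass_add, mass_sum_smul_law, mass_sum_smul_law, ← ENNReal.coe_add]
  refine ENNReal.le_ofReal_iff_toReal_le (by simp) ?_ |>.2 ?_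
  · exact add_nonneg (by positivity) (D.rest.mass.coe_nonneg.trans D.mass_rest_le)
  have habs (a b : ℝ≥0) : ((a - b : ℝ≥0) : ℝ) + ((b - a : ℝ≥0) : ℝ) = |(a : ℝ) - b| := by
    rcases le_total a b with hab | hab
    · rw [tsub_eq_zero_of_le hab, NNReal.coe_sub hab,
        abs_of_nonpos (sub_nonpos.2 (NNReal.coe_le_coe.2 hab))]
      simp
    · rw [tsub_eq_zero_of_le hab, NNReal.coe_sub hab,
        abs_of_nonneg (sub_nonneg.2 (NNReal.coe_le_coe.2 hab))]
      simp
  simp only [← habs, Finset.sum_add_distrib, ENNReal.coe_toReal, NNReal.coe_add, NNReal.coe_sum]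
  linarith [D.mass_rest_le]

/-- The plan is the combination of product laws with coefficients `m i j`. Each law lies within `ε`
of its centre, whence the `2 * ε` in the cost. -/
theorem W₁_sum_smul_law_le {x : ι → E} {ε : ℝ} (hε : 0 ≤ ε) {μ ν : FiniteMeasure E}
    (D : Discretization x ε μ) (D' : Discretization x ε ν) (m : ι → ι → ℝ≥0) :
    W₁ (∑ i, (∑ j, m i j) • D.law i) (∑ j, (∑ i, m i j) • D'.law j) ≤
      ENNReal.ofReal (∑ i, ∑ j, m i j * (dist (x i) (x j) + 2 * ε)) := by
  have prob (i) : IsProbabilityMeasure (D.law i : Measure E) :=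
    ⟨by rw [← FiniteMeasure.ennreal_mass, D.mass_law, ENNReal.coe_one]⟩
  have prob' (i) : IsProbabilityMeasure (D'.law i : Measure E) :=
    ⟨by rw [← FiniteMeasure.ennreal_mass, D'.mass_law, ENNReal.coe_one]⟩
  refine (iInf₂_le (∑ i, ∑ j, m i j • (D.law i : Measure E).prod (D'.law j : Measure E))
    ⟨?_, ?_⟩).trans ?_
  · rw [lintegral_finsetSum_measure, ENNReal.ofReal_sum_of_nonneg (fun i _ ↦ by positivity)]
    refine Finset.sum_le_sum fun i _ ↦ ?_
    rw [lintegral_finsetSum_measure, ENNReal.ofReal_sum_of_nonneg (fun i _ ↦ by positivity)]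
    refine Finset.sum_le_sum fun j _ ↦ ?_
    rw [lintegral_smul_measure, ENNReal.ofReal_mul (by positivity), ENNReal.ofReal_coe_nnreal,
      ENNReal.smul_def, smul_eq_mul]
    gcongr
    have h₁ := (Measure.quasiMeasurePreserving_fst (μ := (D.law i : Measure E))
      (ν := (D'.law j : Measure E))).ae (D.ae_dist_le i)
    have h₂ := (Measure.quasiMeasurePreserving_snd (μ := (D.law i : Measure E))
      (ν := (D'.law j : Measure E))).ae (D'.ae_dist_le j)
    refine (lintegral_mono_ae (g := fun _ ↦ ENNReal.ofReal (dist (x i) (x j) + 2 * ε)) ?_).trans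
      (by simp)
    filter_upwards [h₁, h₂] with z hz₁ hz₂
    rw [edist_dist]
    refine ENNReal.ofReal_le_ofReal ?_
    have := dist_triangle4 z.1 (x i) (x j) z.2
    rw [dist_comm (x j)] at this
    linarith
  · rw [Measure.map_finset_sum' measurable_fst.aemeasurable, FiniteMeasure.toMeasure_sum]
    refine Finset.sum_congr rfl fun i _ ↦ ?_
    rw [Measure.map_finset_sum' measurable_fst.aemeasurable, FiniteMeasure.toMeasure_smul,
      Finset.sum_smul]
    simp [Measure.map_smul]
  · rw [Finset.sum_comm, Measure.map_finset_sum' measurable_snd.aemeasurable,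
      FiniteMeasure.toMeasure_sum]
    refine Finset.sum_congr rfl fun i _ ↦ ?_
    rw [Measure.map_finset_sum' measurable_snd.aemeasurable, FiniteMeasure.toMeasure_smul,
      Finset.sum_smul]
    simp [Measure.map_smul]

theorem genW₁_le_matrixCost {x : ι → E} {ε : ℝ} (hε : 0 ≤ ε) {μ ν : FiniteMeasure E}
    (D : Discretization x ε μ) (D' : Discretization x ε ν) (m : ι → ι → ℝ≥0) :
    genW₁ 1 1 μ ν ≤ ENNReal.ofReal (matrixCost (fun i j ↦ dist (x i) (x j) + 2 * ε)
      (fun i ↦ D.weight i) (fun j ↦ D'.weight j) m + 2 * ε) := by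
  refine (iInf_le_of_le (∑ i, (∑ j, m i j) • D.law i)
    (iInf_le_of_le (∑ j, (∑ i, m i j) • D'.law j) (iInf_le _ ?_))).trans ?_
  · rw [mass_sum_smul_law, mass_sum_smul_law, Finset.sum_comm]
  · simp only [ENNReal.coe_one, one_mul]
    refine (add_le_add (add_le_add (D.mass_diff_le _) (D'.mass_diff_le _))
      (W₁_sum_smul_law_le hε D D' m)).trans_eq ?_
    rw [← ENNReal.ofReal_add (by positivity) (by positivity),
      ← ENNReal.ofReal_add (by positivity) (by positivity), matrixCost]
    congr 1
    push_cast
    ring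

theorem Discretization.le_integral [OpensMeasurableSpace E] {x : ι → E} {ε : ℝ}
    {μ : FiniteMeasure E} (D : Discretization x ε μ) {φ : E →ᵇ ℝ} (hφ : ‖φ‖ ≤ 1) {l : ι → ℝ}
    (hl : ∀ i y, dist y (x i) ≤ ε → l i ≤ φ y) :
    ∑ i, D.weight i * l i - ε ≤ ∫ y, φ y ∂(μ : Measure E) := by
  have h : ∫ y, φ y ∂(μ : Measure E) =
      ∑ i, D.weight i * ∫ y, φ y ∂(D.law i : Measure E) + ∫ y, φ y ∂(D.rest : Measure E) := by
    conv_lhs => rw [D.eq_add, FiniteMeasure.toMeasure_add]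
    rw [integral_add_measure (φ.integrable _) (φ.integrable _), FiniteMeasure.toMeasure_sum,
      integral_finsetSum_measure fun i _ ↦ φ.integrable _]
    simp [FiniteMeasure.toMeasure_smul, integral_smul_nnreal_measure, NNReal.smul_def]
  have hrest := abs_integral_le_mass hφ D.rest
  have hlaw (i) : l i ≤ ∫ y, φ y ∂(D.law i : Measure E) := by
    have : IsProbabilityMeasure (D.law i : Measure E) :=
      ⟨by rw [← FiniteMeasure.ennreal_mass, D.mass_law, ENNReal.coe_one]⟩
    calc l i = ∫ _, l i ∂(D.law i : Measure E) := by simp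
      _ ≤ _ := integral_mono_ae (integrable_const _) (φ.integrable _)
        ((D.ae_dist_le i).mono fun y ↦ hl i y)
  have hsum : ∑ i, D.weight i * l i ≤ ∑ i, D.weight i * ∫ y, φ y ∂(D.law i : Measure E) :=
    Finset.sum_le_sum fun i _ ↦ mul_le_mul_of_nonneg_left (hlaw i) (D.weight i).coe_nonneg
  rw [h]
  linarith [(abs_le.1 hrest).1, D.mass_rest_le]

theorem Discretization.exists_blBall_genW₁_le [OpensMeasurableSpace E] {x : ι → E} {ε : ℝ}
    (hε : 0 < ε) {μ ν : FiniteMeasure E} (D : Discretization x ε μ) (D' : Discretization x ε ν) :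
    ∃ f ∈ blBall E, (genW₁ 1 1 μ ν).toReal ≤
      ∫ y, f y ∂(μ : Measure E) - ∫ y, f y ∂(ν : Measure E) +
        ε * (3 * μ.mass + ν.mass + 5) := by
  obtain ⟨φ, ψ, hφ, hψ, hφψ, hm⟩ := exists_dual_potentials
    (c := fun i j ↦ dist (x i) (x j) + 2 * ε) (fun i j ↦ by positivity)
    (fun i ↦ (D.weight i : ℝ)) (fun j ↦ (D'.weight j : ℝ))
  obtain ⟨m, hm⟩ := hm ε hε
  obtain ⟨f, hf, hfy⟩ := exists_mem_blBall_of_potentials (x := x) hε.le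
    (fun i ↦ (abs_le.1 (hφ i)).2) (fun j ↦ (abs_le.1 (hψ j)).2) hφψ
  refine ⟨f, hf, ?_⟩
  have h₁ := D.le_integral hf.1 fun i y hy ↦ (hfy i y hy).1
  -- In the final bound, the 5 counts one `ε` for the near-optimal `m`, two from
  -- `genW₁_le_matrixCost` and one per remainder in `h₁` and `h₂`.
  have h₂ := D'.le_integral (φ := -f) (l := fun j ↦ ψ j - ε) (by rw [norm_neg]; exact hf.1)
    fun i y hy ↦ by
      have := (hfy i y hy).2
      rw [BoundedContinuousFunction.coe_neg, Pi.neg_apply]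
      linarith
  simp only [BoundedContinuousFunction.coe_neg, Pi.neg_apply, integral_neg] at h₂
  have h₃ := ENNReal.toReal_le_of_le_ofReal
    (add_nonneg (matrixCost_nonneg (fun i j ↦ by positivity) _ _ m) (by positivity))
    (genW₁_le_matrixCost hε.le D D' m)
  simp only [mul_sub, Finset.sum_sub_distrib, ← Finset.sum_mul] at h₁ h₂
  have h₄ := mul_le_mul_of_nonneg_right D.sum_weight_le hε.le
  have h₅ := mul_le_mul_of_nonneg_right D'.sum_weight_le hε.le
  linarith

end Discretization

/-! ### Existence of discretizations and strong duality -/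

section Existence

variable [PseudoMetricSpace E] [OpensMeasurableSpace E]

/-- The normalized restriction of `μ` to `A`, or a Dirac mass if `A` is negligible. -/
theorem exists_law_restrict (μ : FiniteMeasure E) {A : Set E} (hA : MeasurableSet A) {x : E}
    {ε : ℝ} (hε : 0 ≤ ε) (hx : ∀ y ∈ A, dist y x ≤ ε) :
    ∃ p : FiniteMeasure E, p.mass = 1 ∧ (∀ᵐ y ∂(p : Measure E), dist y x ≤ ε) ∧
      μ.restrict A = μ A • p := by
  by_cases h : μ A = 0
  · refine ⟨ProbabilityMeasure.toFiniteMeasure ⟨Measure.dirac x, inferInstance⟩, ?_, ?_, ?_⟩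
    · exact ProbabilityMeasure.mass_toFiniteMeasure _
    · refine (ae_dirac_iff ?_).2 (by simpa using hε)
      exact Metric.isClosed_closedBall.measurableSet
    · rw [h, zero_smul, FiniteMeasure.restrict_eq_zero_iff, h]
  · refine ⟨(μ A)⁻¹ • μ.restrict A, ?_, ?_, ?_⟩
    · rw [mass_smul, FiniteMeasure.restrict_mass, inv_mul_cancel₀ h]
    · rw [FiniteMeasure.toMeasure_smul, FiniteMeasure.restrict_measure_eq]
      exact Measure.ae_smul_measure ((ae_restrict_mem hA).mono hx) _
    · rw [smul_smul, mul_inv_cancel₀ h, one_smul]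

theorem exists_discretization {N : ℕ} {A : ℕ → Set E} (hA : ∀ n, MeasurableSet (A n))
    (hdisj : Pairwise fun n m ↦ Disjoint (A n) (A m)) {x : ℕ → E} {ε : ℝ} (hε : 0 ≤ ε)
    (hx : ∀ n, ∀ y ∈ A n, dist y (x n) ≤ ε) (μ : FiniteMeasure E)
    (hN : (μ : Measure E) (⋃ i : Fin N, A i)ᶜ ≤ ENNReal.ofReal ε) :
    Nonempty (Discretization (fun i : Fin N ↦ x i) ε μ) := by
  choose p hp hpx hpA using fun i : Fin N ↦ exists_law_restrict μ (hA i) hε (hx i)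
  refine ⟨⟨fun i ↦ μ (A i), p, μ.restrict (⋃ i : Fin N, A i)ᶜ, hp, hpx, ?_, ?_⟩⟩
  · rw [FiniteMeasure.restrict_mass]
    exact ENNReal.toReal_le_of_le_ofReal hε hN
  · simp only [← hpA]
    rw [← FiniteMeasure.restrict_biUnion_finset
      (fun i _ j _ hij ↦ hdisj (Fin.val_injective.ne hij)) fun i ↦ hA i]
    simp only [Finset.mem_univ, Set.iUnion_true]
    rw [← FiniteMeasure.restrict_union disjoint_compl_right
      (MeasurableSet.iUnion fun i : Fin N ↦ hA i).compl, Set.union_compl_self,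
      FiniteMeasure.restrict_univ]

theorem exists_blBall_genW₁_le [TopologicalSpace.SeparableSpace E] [Nonempty E]
    (μ ν : FiniteMeasure E) {δ : ℝ} (hδ : 0 < δ) :
    ∃ f ∈ blBall E, (genW₁ 1 1 μ ν).toReal ≤
      ∫ y, f y ∂(μ : Measure E) - ∫ y, f y ∂(ν : Measure E) + δ := by
  set C : ℝ := 3 * μ.mass + ν.mass + 5
  have hC : 0 < C := by positivity
  obtain ⟨A, hA, hbdd, hdiam, hcover, hdisj⟩ :=
    SeparableSpace.exists_measurable_partition_diam_le E (div_pos hδ hC)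
  have hε : 0 < δ / C := by positivity
  have hx (n) : ∃ x, ∀ y ∈ A n, dist y x ≤ δ / C := by
    rcases (A n).eq_empty_or_nonempty with h | ⟨x, hx⟩
    · exact ⟨Classical.arbitrary E, by simp [h]⟩
    · exact ⟨x, fun y hy ↦ (Metric.dist_le_diam_of_mem (hbdd n) hy hx).trans (hdiam n)⟩
  choose x hx using hx
  -- Stated for every finite measure, so that one `N` serves both `μ` and `ν`: their discretizations
  -- must share the same centres.
  have htail (μ : FiniteMeasure E) : ∀ᶠ N in Filter.atTop,
      (μ : Measure E) (⋃ i : Fin N, A i)ᶜ ≤ ENNReal.ofReal (δ / C) := by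
    have := tendsto_measure_biUnion_Ici_zero_of_pairwise_disjoint (μ := (μ : Measure E))
      (fun n ↦ (hA n).nullMeasurableSet) hdisj
    filter_upwards [this.eventually_le_const (ENNReal.ofReal_pos.2 hε)] with N hN
    refine (measure_mono fun y hy ↦ ?_).trans hN
    obtain ⟨n, hn⟩ := Set.mem_iUnion.1 (hcover.ge (Set.mem_univ y))
    refine Set.mem_biUnion (x := n) (show N ≤ n from not_lt.1 fun hnN ↦ hy ?_) hn
    exact Set.mem_iUnion.2 ⟨⟨n, hnN⟩, hn⟩
  obtain ⟨N, hN, hN'⟩ := ((htail μ).and (htail ν)).exists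
  obtain ⟨D⟩ := exists_discretization hA hdisj hε.le hx μ hN
  obtain ⟨D'⟩ := exists_discretization hA hdisj hε.le hx ν hN'
  obtain ⟨f, hf, h⟩ := D.exists_blBall_genW₁_le hε D'
  exact ⟨f, hf, h.trans_eq (by rw [div_mul_cancel₀ _ hC.ne'])⟩

/-- Kantorovich duality for finite positive measures. -/
theorem isLUB_blValues_diff [TopologicalSpace.SeparableSpace E] [Nonempty E]
    (μ ν : FiniteMeasure E) :
    IsLUB (blValues (diff μ ν)) (genW₁ 1 1 μ ν).toReal := by
  refine ⟨?_, fun b hb ↦ le_of_forall_pos_le_add fun δ hδ ↦ ?_⟩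
  · rintro _ ⟨φ, hφ, rfl⟩
    rw [integral_diff]
    exact (ENNReal.ofReal_le_iff_le_toReal (genW₁_ne_top μ ν)).1
      (integral_sub_integral_le_genW₁ μ ν hφ)
  · obtain ⟨f, hf, h⟩ := exists_blBall_genW₁_le μ ν hδ
    rw [← integral_diff] at h
    linarith [hb ⟨f, hf, rfl⟩]

/-- Both sides are suprema of the same set of dual values; finiteness lets the equality pass back
from `ℝ` to `ℝ≥0∞`. -/
theorem genW₁_eq_of_diff_eq [TopologicalSpace.SeparableSpace E] [Nonempty E]
    {μ ν μ' ν' : FiniteMeasure E} (h : diff μ ν = diff μ' ν') :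
    genW₁ 1 1 μ ν = genW₁ 1 1 μ' ν' := by
  refine (ENNReal.toReal_eq_toReal_iff' (genW₁_ne_top _ _) (genW₁_ne_top _ _)).1 ?_
  have h₁ := isLUB_blValues_diff μ ν
  rw [h] at h₁
  exact h₁.unique (isLUB_blValues_diff μ' ν')

end Existence

end SignedWasserstein

/-- Kantorovich duality. The first clause says that `𝕎₁^{1,1}(μ, ν)` can be computed with any
decompositions of `μ` and `ν` into differences of finite positive measures. -/
theorem proposition23 (d : ℕ) (μ ν : SignedMeasure (EuclideanSpace ℝ (Fin d))) :
    (∀ μp μm νp νm : FiniteMeasure (EuclideanSpace ℝ (Fin d)),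
      μ = SignedWasserstein.diff μp μm → ν = SignedWasserstein.diff νp νm →
        SignedWasserstein.signedW₁ 1 1 μ ν =
          SignedWasserstein.genW₁ 1 1 (μp + νm) (μm + νp)) ∧
    SignedWasserstein.signedW₁ 1 1 μ ν ≠ ∞ ∧
    IsLUB (SignedWasserstein.blValues (μ - ν)) (SignedWasserstein.signedW₁ 1 1 μ ν).toReal ∧
    SignedWasserstein.normW₁ 1 1 μ ≠ ∞ ∧
    IsLUB (SignedWasserstein.blValues μ) (SignedWasserstein.normW₁ 1 1 μ).toReal := by
  have hlub (μ ν : SignedMeasure (EuclideanSpace ℝ (Fin d))) :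
      IsLUB (SignedWasserstein.blValues (μ - ν)) (SignedWasserstein.signedW₁ 1 1 μ ν).toReal := by
    rw [← SignedWasserstein.diff_signed μ ν]
    exact SignedWasserstein.isLUB_blValues_diff _ _
  refine ⟨fun μp μm νp νm hμ hν ↦ SignedWasserstein.genW₁_eq_of_diff_eq ?_,
    SignedWasserstein.genW₁_ne_top _ _, hlub μ ν, SignedWasserstein.genW₁_ne_top _ _, ?_⟩
  · rw [SignedWasserstein.diff_signed, ← SignedWasserstein.diff_sub_diff, ← hμ, ← hν]
  · simpa [SignedWasserstein.normW₁] using hlub μ 0
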